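/- Let $n$ be a natural number. A *substitution algebra with transpositions of dimension $n$* is a Boolean algebra $A$ with unary operations $s^i_j$ and $s_{ij}$ for all distinct $i,j<n$ (corresponding to the replacement $[i|j]$, which sends $i$ to $j$ and fixes everything else, and to the transposition $[i,j]$), all of which are Boolean endomorphisms, such that the following equations hold for all $x\in A$ and all indices below $n$, where the distinct letters of each equation denote distinct indices: $$s_{ij}x=s_{ji}x,\quad s_{ij}s_{ij}x=x,\quad s_{ij}s_{jk}s_{ij}x=s_{ik}x,\quad s_{ij}s_{kl}x=s_{kl}s_{ij}x,$$ $$s_{kl}s^j_is_{kl}x=s^j_ix,\quad s_{jk}s^j_is_{jk}x=s^k_ix,\quad s_{ki}s^j_is_{ki}x=s^j_kx,\quad s_{ij}s^j_is_{ij}x=s^i_jx,$$ $$s^j_is^k_lx=s^k_ls^j_ix,\quad s^j_is^k_ix=s^k_is^j_ix=s^j_is^k_jx,\quad s^j_is^i_kx=s^j_ks_{ij}x,$$ $$s^j_is^j_kx=s^j_kx,\quad s^j_is^j_ix=s^j_ix,\quad s^j_is^i_jx=s^j_ix,\quad s^j_is_{ij}x=s^j_ix.$$ Let $SA_n$ be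 the variety of these algebras. Then: 1. $SA_n$ is locally finite: in every $A\in SA_n$, every finitely generated subalgebra is finite. More precisely, if $A\in SA_n$ is generated by a set of $m$ elements, $m$ finite, then $A$ is finite and $|A|\le 2^{2^{m\cdot n^n}}$. 2. $SA_n$ has the superamalgamation property: for all $A,B,C\in SA_n$ and all monomorphisms $p:A\to B$, $q:A\to C$ there are $D\in SA_n$ and monomorphisms $f:B\to D$, $g:C\to D$ with $f\circ p=g\circ q$ such that for all $b\in B$ and $c\in C$: if $f(b)\le g(c)$, then there is $a\in A$ with $b\le p(a)$ and $q(a)\le c$; and if $g(c)\le f(b)$, then there is $a\in A$ with $c\le q(a)$ and $p(a)\le b$. -/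

import Mathlib

universe u v

/-- Substitution algebras with transpositions of dimension `n`: Boolean algebras with unary operations
`rp i j` (written `s^i_j`, for the replacement `[i|j]`, which sends `i` to `j` and fixes everything
else) and `tr i j` (written `s_{ij}`, for the transposition `[i,j]`), for distinct `i, j < n`. The
equations say that all the operations are Boolean endomorphisms, and encode a presentation of the
monoid of all maps `n → n` by replacements and transpositions (with `s_σ s_τ = s_{σ ∘ τ}`). -/
class SA (n : ℕ) (A : Type u) [BooleanAlgebra A] where
  /-- `tr i j` is the operation `s_{ij}`. -/
  tr (i j : Fin n) (h : i ≠ j) : A → A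
  /-- `rp i j` is the operation `s^i_j`. -/
  rp (i j : Fin n) (h : i ≠ j) : A → A
  -- The operations are Boolean endomorphisms.
  tr_inf (i j : Fin n) (h : i ≠ j) (x y : A) : tr i j h (x ⊓ y) = tr i j h x ⊓ tr i j h y
  tr_compl (i j : Fin n) (h : i ≠ j) (x : A) : tr i j h xᶜ = (tr i j h x)ᶜ
  rp_inf (i j : Fin n) (h : i ≠ j) (x y : A) : rp i j h (x ⊓ y) = rp i j h x ⊓ rp i j h y
  rp_compl (i j : Fin n) (h : i ≠ j) (x : A) : rp i j h xᶜ = (rp i j h x)ᶜ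
  -- The relations between transpositions (symmetric group).
  /-- `s_{ij} x = s_{ji} x` -/
  tr_symm (i j : Fin n) (h : i ≠ j) (x : A) : tr i j h x = tr j i h.symm x
  /-- `s_{ij} s_{ij} x = x` -/
  tr_tr (i j : Fin n) (h : i ≠ j) (x : A) : tr i j h (tr i j h x) = x
  /-- `s_{ij} s_{jk} s_{ij} x = s_{ik} x` -/
  tr_conj (i j k : Fin n) (hij : i ≠ j) (hjk : j ≠ k) (hik : i ≠ k) (x : A) :
    tr i j hij (tr j k hjk (tr i j hij x)) = tr i k hik x
  /-- `s_{ij} s_{kl} x = s_{kl} s_{ij} x` -/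
  tr_comm (i j k l : Fin n) (hij : i ≠ j) (_hik : i ≠ k) (_hil : i ≠ l) (_hjk : j ≠ k)
    (_hjl : j ≠ l) (hkl : k ≠ l) (x : A) :
    tr i j hij (tr k l hkl x) = tr k l hkl (tr i j hij x)
  -- Conjugation of replacements by transpositions.
  /-- `s_{kl} s^j_i s_{kl} x = s^j_i x` -/
  conj_disjoint (i j k l : Fin n) (hij : i ≠ j) (_hik : i ≠ k) (_hil : i ≠ l) (_hjk : j ≠ k)
    (_hjl : j ≠ l) (hkl : k ≠ l) (x : A) :
    tr k l hkl (rp j i hij.symm (tr k l hkl x)) = rp j i hij.symm x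
  /-- `s_{jk} s^j_i s_{jk} x = s^k_i x` -/
  conj_source (i j k : Fin n) (hij : i ≠ j) (hjk : j ≠ k) (hik : i ≠ k) (x : A) :
    tr j k hjk (rp j i hij.symm (tr j k hjk x)) = rp k i hik.symm x
  /-- `s_{ki} s^j_i s_{ki} x = s^j_k x` -/
  conj_target (i j k : Fin n) (hij : i ≠ j) (hjk : j ≠ k) (hik : i ≠ k) (x : A) :
    tr k i hik.symm (rp j i hij.symm (tr k i hik.symm x)) = rp j k hjk x
  /-- `s_{ij} s^j_i s_{ij} x = s^i_j x` -/
  conj_swap (i j : Fin n) (hij : i ≠ j) (x : A) :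
    tr i j hij (rp j i hij.symm (tr i j hij x)) = rp i j hij x
  -- Products of replacements.
  /-- `s^j_i s^k_l x = s^k_l s^j_i x` -/
  rp_comm (i j k l : Fin n) (hij : i ≠ j) (_hik : i ≠ k) (_hil : i ≠ l) (_hjk : j ≠ k)
    (_hjl : j ≠ l) (hkl : k ≠ l) (x : A) :
    rp j i hij.symm (rp k l hkl x) = rp k l hkl (rp j i hij.symm x)
  /-- `s^j_i s^k_i x = s^k_i s^j_i x` -/
  rp_comm_target (i j k : Fin n) (hij : i ≠ j) (_hjk : j ≠ k) (hik : i ≠ k) (x : A) :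
    rp j i hij.symm (rp k i hik.symm x) = rp k i hik.symm (rp j i hij.symm x)
  /-- `s^k_i s^j_i x = s^j_i s^k_j x` -/
  rp_chain (i j k : Fin n) (hij : i ≠ j) (hjk : j ≠ k) (hik : i ≠ k) (x : A) :
    rp k i hik.symm (rp j i hij.symm x) = rp j i hij.symm (rp k j hjk.symm x)
  /-- `s^j_i s^i_k x = s^j_k s_{ij} x` -/
  rp_rp_eq_rp_tr (i j k : Fin n) (hij : i ≠ j) (hjk : j ≠ k) (hik : i ≠ k) (x : A) :
    rp j i hij.symm (rp i k hik x) = rp j k hjk (tr i j hij x)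
  /-- `s^j_i s^j_k x = s^j_k x` -/
  rp_absorb (i j k : Fin n) (hij : i ≠ j) (hjk : j ≠ k) (_hik : i ≠ k) (x : A) :
    rp j i hij.symm (rp j k hjk x) = rp j k hjk x
  /-- `s^j_i s^j_i x = s^j_i x` -/
  rp_idem (i j : Fin n) (hij : i ≠ j) (x : A) :
    rp j i hij.symm (rp j i hij.symm x) = rp j i hij.symm x
  /-- `s^j_i s^i_j x = s^j_i x` -/
  rp_rp_swap (i j : Fin n) (hij : i ≠ j) (x : A) :
    rp j i hij.symm (rp i j hij x) = rp j i hij.symm x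
  /-- `s^j_i s_{ij} x = s^j_i x` -/
  rp_tr (i j : Fin n) (hij : i ≠ j) (x : A) :
    rp j i hij.symm (tr i j hij x) = rp j i hij.symm x

namespace SA

/-- `S` is (the universe of) a subalgebra. The constant `⊥` is the value of the term `x ⊓ xᶜ`. -/
structure IsSubalgebra (n : ℕ) {A : Type u} [BooleanAlgebra A] [SA n A] (S : Set A) : Prop where
  bot_mem : ⊥ ∈ S
  inf_mem : ∀ x ∈ S, ∀ y ∈ S, x ⊓ y ∈ S
  compl_mem : ∀ x ∈ S, xᶜ ∈ S
  tr_mem : ∀ (i j : Fin n) (h : i ≠ j), ∀ x ∈ S, tr i j h x ∈ S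
  rp_mem : ∀ (i j : Fin n) (h : i ≠ j), ∀ x ∈ S, rp i j h x ∈ S

/-- The subalgebra generated by `X`. -/
def Sg (n : ℕ) {A : Type u} [BooleanAlgebra A] [SA n A] (X : Set A) : Set A :=
  ⋂₀ {S : Set A | IsSubalgebra n S ∧ X ⊆ S}

/-- `f` is a monomorphism (injective homomorphism) of substitution algebras. -/
structure IsMono (n : ℕ) {A : Type u} {B : Type v} [BooleanAlgebra A] [SA n A]
    [BooleanAlgebra B] [SA n B] (f : A → B) : Prop where
  injective : Function.Injective f
  map_inf : ∀ x y : A, f (x ⊓ y) = f x ⊓ f y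
  map_compl : ∀ x : A, f xᶜ = (f x)ᶜ
  map_tr : ∀ (i j : Fin n) (h : i ≠ j) (x : A), f (tr i j h x) = tr i j h (f x)
  map_rp : ∀ (i j : Fin n) (h : i ≠ j) (x : A), f (rp i j h x) = rp i j h (f x)

/-- Local finiteness: finitely generated subalgebras are finite. -/
def LocallyFinite (n : ℕ) : Prop :=
  ∀ (A : Type u) [BooleanAlgebra A] [SA n A] (X : Set A), X.Finite → (Sg n X).Finite

/-- The superamalgamation property of the class of `n`-dimensional substitution algebras. -/
def SuperAmalgamation (n : ℕ) : Prop :=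
  ∀ (A B C : Type u) [BooleanAlgebra A] [BooleanAlgebra B] [BooleanAlgebra C]
    [SA n A] [SA n B] [SA n C] (p : A → B) (q : A → C), IsMono n p → IsMono n q →
    ∃ (D : Type u) (_ : BooleanAlgebra D) (_ : SA n D) (f : B → D) (g : C → D),
      IsMono n f ∧ IsMono n g ∧ (∀ a : A, f (p a) = g (q a)) ∧
      (∀ (b : B) (c : C), f b ≤ g c → ∃ a : A, b ≤ p a ∧ q a ≤ c) ∧
      (∀ (b : B) (c : C), g c ≤ f b → ∃ a : A, c ≤ q a ∧ p a ≤ b)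

end SA

/-!
The defining equations present the monoid of all self-maps of `n` by the replacements and the
transpositions. To see this, extend the index set one point at a time: the equations bring every
word in the indices `insert a s` to the form `[a, j] [a|i] w` with `w` a word in the indices `s`,
and words of this form are compared through the self-maps they denote. A substitution algebra of
dimension `n` is therefore a Boolean algebra on which the monoid of the self-maps `τ` of `n` acts
by endomorphisms `s_τ`.

Consequently the subalgebra generated by `m` elements `x` is the Boolean subalgebra generated by
the at most `m * n ^ n` elements `s_τ x`, whence the bound. For amalgamation, take the powerset of
the pullback of the dual spaces of `B` and `C` over that of `A`, on which the self-maps act through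
their action on the points. If no element of `A` interpolates between `b` and `c`, then a suitable
ultrafilter of `A` extends both to an ultrafilter of `B` that contains `b` and to one of `C` that
does not contain `c`. This pair is a point of the pullback that separates `b` from `c`.
-/

namespace SA

section Transformations

variable {α M N : Type*}

/-- The transposition `[a, b]` as a self-map of `α`. -/
def swapMap [DecidableEq α] (a b : α) : Function.End α := fun x => Equiv.swap a b x

/-- The replacement `[a|b]` as a self-map of `α`: it sends `a` to `b` and fixes everything else. -/
def replMap [DecidableEq α] (a b : α) : Function.End α := fun x => if x = a then b else x

/-- The relations that present the monoid of self-maps of a finite set by transpositions `t a b` and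
replacements `r a b`. The indices need not be distinct, and `t a a = r a a = 1`: this allows the
conjugation relations `t_mul_t` and `t_mul_r` to be stated without case distinctions. -/
structure TransformationRelations [DecidableEq α] [Monoid M] (t r : α → α → M) : Prop where
  t_self (a : α) : t a a = 1
  r_self (a : α) : r a a = 1
  t_mul_t_self (a b : α) : t a b * t a b = 1
  t_mul_t (a b c d : α) : t a b * t c d = t (Equiv.swap a b c) (Equiv.swap a b d) * t a b
  t_mul_r (a b c d : α) : t a b * r c d = r (Equiv.swap a b c) (Equiv.swap a b d) * t a b
  t_mul_r_self (a b : α) : t a b * r a b = r b a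
  r_comm {a b c d : α} (hca : c ≠ a) (hcb : c ≠ b) (hda : d ≠ a) : r a b * r c d = r c d * r a b
  r_chain {a b c : α} (hab : a ≠ b) (hac : a ≠ c) : r b c * r a b = r a c * r b c
  r_absorb {a b : α} (c : α) (hab : a ≠ b) : r a c * r a b = r a b
  r_mul_r (a : α) {b c : α} (hbc : b ≠ c) : r a b * r b c = t a b * r b c

/-- The submonoid generated by the transpositions and replacements with indices in `s`. -/
def words [Monoid M] (t r : α → α → M) (s : Finset α) : Submonoid M :=
  Submonoid.closure {x | ∃ a ∈ s, ∃ b ∈ s, x = t a b ∨ x = r a b}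

theorem t_mem_words [Monoid M] {t r : α → α → M} {s : Finset α} {a b : α} (ha : a ∈ s)
    (hb : b ∈ s) : t a b ∈ words t r s :=
  Submonoid.subset_closure ⟨a, ha, b, hb, Or.inl rfl⟩

theorem r_mem_words [Monoid M] {t r : α → α → M} {s : Finset α} {a b : α} (ha : a ∈ s)
    (hb : b ∈ s) : r a b ∈ words t r s :=
  Submonoid.subset_closure ⟨a, ha, b, hb, Or.inr rfl⟩

theorem map_words [Monoid M] [Monoid N] (π : M →* N) (t r : α → α → M) (s : Finset α) :
    (words t r s).map π = words (fun a b => π (t a b)) (fun a b => π (r a b)) s := by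
  rw [words, words, MonoidHom.map_mclosure]
  congr 1
  aesop

theorem swap_mem [DecidableEq α] {s : Finset α} {a b c : α} (ha : a ∈ s) (hb : b ∈ s)
    (hc : c ∈ s) : Equiv.swap a b c ∈ s := by
  rw [Equiv.swap_apply_def]
  split_ifs <;> assumption

theorem end_mul_apply (f g : Function.End α) (x : α) : (f * g) x = f (g x) := rfl

section SelfMaps

variable [DecidableEq α]

theorem transformationRelations_swapMap_replMap :
    TransformationRelations (swapMap : α → α → Function.End α) replMap := by
  constructor <;> intros <;> funext x <;>
    simp only [swapMap, replMap, end_mul_apply, Function.End.one_def, id_eq,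
      Equiv.swap_apply_def] <;>
    grind

/-- The monoid of the self-maps of `α` that map `s` into itself and fix all other points. -/
def selfMapsOn (s : Finset α) : Submonoid (Function.End α) where
  carrier := {f | Set.MapsTo f s s ∧ ∀ c ∉ s, f c = c}
  one_mem' := ⟨fun _ hc => hc, fun _ _ => rfl⟩
  mul_mem' hf hg := ⟨hf.1.comp hg.1, fun c hc => (congrArg _ (hg.2 c hc)).trans (hf.2 c hc)⟩

theorem swapMap_mem_selfMapsOn {s : Finset α} {a b : α} (ha : a ∈ s) (hb : b ∈ s) :
    swapMap a b ∈ selfMapsOn s :=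
  ⟨fun _ hc => swap_mem ha hb hc, fun _ hc => Equiv.swap_apply_of_ne_of_ne (by grind) (by grind)⟩

theorem replMap_mem_selfMapsOn {s : Finset α} {a b : α} (ha : a ∈ s) (hb : b ∈ s) :
    replMap a b ∈ selfMapsOn s :=
  ⟨fun c hc => by simp only [replMap]; split_ifs; exacts [hb, hc], fun c hc => if_neg (by grind)⟩

theorem words_swapMap_replMap_le (s : Finset α) : words swapMap replMap s ≤ selfMapsOn s := by
  rw [words, Submonoid.closure_le]
  rintro _ ⟨a, ha, b, hb, rfl | rfl⟩
  exacts [swapMap_mem_selfMapsOn ha hb, replMap_mem_selfMapsOn ha hb]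

theorem mrange_toEndHom_perm_le [Fintype α] :
    MonoidHom.mrange (MulAction.toEndHom : Equiv.Perm α →* Function.End α) ≤
      words swapMap replMap Finset.univ := by
  rw [MonoidHom.mrange_eq_map, ← Equiv.Perm.mclosure_isSwap, MonoidHom.map_mclosure,
    Submonoid.closure_le]
  rintro _ ⟨_, ⟨a, b, -, rfl⟩, rfl⟩
  exact t_mem_words (Finset.mem_univ a) (Finset.mem_univ b)

theorem exists_eq_mul_replMap {f : Function.End α} {a b : α} (hab : a ≠ b) (hfab : f a = f b)
    {j : α} (hj : j ∉ Set.range f) :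
    ∃ g : Function.End α, f = g * replMap a b ∧ Set.range f < Set.range g := by
  refine ⟨fun c => if c = a then j else f c, ?_, ?_, fun h => hj (h ⟨a, if_pos rfl⟩)⟩
  · funext c
    change f c = if replMap a b c = a then j else f (replMap a b c)
    simp only [replMap]
    grind
  · rintro _ ⟨c, rfl⟩
    by_cases hca : c = a
    · exact ⟨b, (if_neg hab.symm).trans (hca ▸ hfab.symm)⟩
    · exact ⟨c, if_neg hca⟩

theorem words_swapMap_replMap_univ [Fintype α] :
    words (swapMap : α → α → Function.End α) replMap Finset.univ = ⊤ := by
  refine eq_top_iff.2 fun f _ => ?_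
  induction hR : Set.range f using WellFoundedGT.induction generalizing f with
  | ind R ih =>
    by_cases hf : Function.Injective f
    · exact mrange_toEndHom_perm_le
        ⟨Equiv.ofBijective f (Finite.injective_iff_bijective.1 hf), rfl⟩
    obtain ⟨j, hj⟩ := (Set.ne_univ_iff_exists_notMem _).1
      (mt (Finite.injective_iff_surjective.2 ∘ Set.range_eq_univ.1) hf)
    obtain ⟨a, b, hfab, hab⟩ := Function.not_injective_iff.1 hf
    obtain ⟨g, rfl, hlt⟩ := exists_eq_mul_replMap hab hfab hj
    exact mul_mem (ih _ (hR ▸ hlt) _ trivial rfl)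
      (r_mem_words (Finset.mem_univ a) (Finset.mem_univ b))

end SelfMaps

/-- The homomorphism `π` sends each transposition and each replacement to the self-map of that
name, so that `π w` is the self-map denoted by the word `w`. -/
structure IsEvaluation [DecidableEq α] [Monoid M] (t r : α → α → M) (π : M →* Function.End α) :
    Prop where
  map_t (a b : α) : π (t a b) = swapMap a b
  map_r (a b : α) : π (r a b) = replMap a b

/-- The normal form `[a, j] [a|i] w`, with `w` a word over `s`, of a word over `insert a s`. -/
def IsNormal [DecidableEq α] [Monoid M] (t r : α → α → M) (a : α) (s : Finset α) (x : M) : Prop :=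
  ∃ j ∈ insert a s, ∃ i ∈ insert a s, ∃ w ∈ words t r s, x = t a j * (r a i * w)

variable [DecidableEq α] [Monoid M] [Monoid N] {t r : α → α → M} {s : Finset α} {a b c i j : α}

namespace TransformationRelations

theorem prod {t' r' : α → α → N} (h : TransformationRelations t r)
    (h' : TransformationRelations t' r') :
    TransformationRelations (fun a b => (t a b, t' a b)) (fun a b => (r a b, r' a b)) where
  t_self a := Prod.ext (h.t_self a) (h'.t_self a)
  r_self a := Prod.ext (h.r_self a) (h'.r_self a)
  t_mul_t_self a b := Prod.ext (h.t_mul_t_self a b) (h'.t_mul_t_self a b)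
  t_mul_t a b c d := Prod.ext (h.t_mul_t a b c d) (h'.t_mul_t a b c d)
  t_mul_r a b c d := Prod.ext (h.t_mul_r a b c d) (h'.t_mul_r a b c d)
  t_mul_r_self a b := Prod.ext (h.t_mul_r_self a b) (h'.t_mul_r_self a b)
  r_comm h₁ h₂ h₃ := Prod.ext (h.r_comm h₁ h₂ h₃) (h'.r_comm h₁ h₂ h₃)
  r_chain h₁ h₂ := Prod.ext (h.r_chain h₁ h₂) (h'.r_chain h₁ h₂)
  r_absorb c h₁ := Prod.ext (h.r_absorb c h₁) (h'.r_absorb c h₁)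
  r_mul_r a _ _ h₁ := Prod.ext (h.r_mul_r a h₁) (h'.r_mul_r a h₁)

variable (h : TransformationRelations t r)
include h

theorem t_mul_t_mul (a b : α) (x : M) : t a b * (t a b * x) = x := by
  rw [← mul_assoc, h.t_mul_t_self, one_mul]

theorem t_symm (a b : α) : t a b = t b a := by
  have hconj : t a b * t a b = t b a * t a b := by
    simpa only [Equiv.swap_apply_left, Equiv.swap_apply_right] using h.t_mul_t a b a b
  simpa only [mul_assoc, h.t_mul_t_self, mul_one, one_mul] using congrArg (· * t a b) hconj

theorem isNormal_r_mul {w : M} (hi : i ∈ insert a s) (hw : w ∈ words t r s) :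
    IsNormal t r a s (r a i * w) :=
  ⟨a, Finset.mem_insert_self a s, i, hi, w, hw, by rw [h.t_self, one_mul]⟩

theorem isNormal_t_mul_of_mem {x : M} (ha : a ∉ s) (hb : b ∈ s) (hc : c ∈ s)
    (hx : IsNormal t r a s x) : IsNormal t r a s (t b c * x) := by
  obtain ⟨j, hj, i, hi, w, hw, rfl⟩ := hx
  have hb' := Finset.mem_insert_of_mem (b := a) hb
  have hc' := Finset.mem_insert_of_mem (b := a) hc
  have hab : a ≠ b := fun e => ha (e ▸ hb)
  have hac : a ≠ c := fun e => ha (e ▸ hc)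
  refine ⟨Equiv.swap b c j, swap_mem hb' hc' hj, Equiv.swap b c i, swap_mem hb' hc' hi,
    t b c * w, mul_mem (t_mem_words hb hc) hw, ?_⟩
  rw [← mul_assoc, h.t_mul_t, mul_assoc, ← mul_assoc (t b c), h.t_mul_r,
    Equiv.swap_apply_of_ne_of_ne hab hac, mul_assoc]

theorem isNormal_t_mul_self {x : M} (ha : a ∉ s) (hc : c ∈ insert a s)
    (hx : IsNormal t r a s x) : IsNormal t r a s (t a c * x) := by
  obtain ⟨j, hj, i, hi, w, hw, rfl⟩ := id hx
  rcases Finset.mem_insert.1 hc with rfl | hcs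
  · rwa [h.t_self, one_mul]
  rcases Finset.mem_insert.1 hj with rfl | hjs
  · exact ⟨c, hc, i, hi, w, hw, by rw [h.t_self, one_mul]⟩
  have hja : j ≠ a := fun e => ha (e ▸ hjs)
  by_cases hjc : j = c
  · subst hjc
    rw [h.t_mul_t_mul]
    exact h.isNormal_r_mul hi hw
  have hcomm : t a c * t a j = t c j * t a c := by
    rw [h.t_mul_t, Equiv.swap_apply_left, Equiv.swap_apply_of_ne_of_ne hja hjc]
  rw [← mul_assoc, hcomm, mul_assoc]
  exact h.isNormal_t_mul_of_mem ha hcs hjs ⟨c, hc, i, hi, w, hw, rfl⟩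

theorem isNormal_t_mul {x : M} (ha : a ∉ s) (hb : b ∈ insert a s) (hc : c ∈ insert a s)
    (hx : IsNormal t r a s x) : IsNormal t r a s (t b c * x) := by
  rcases Finset.mem_insert.1 hb with rfl | hbs
  · exact h.isNormal_t_mul_self ha hc hx
  rcases Finset.mem_insert.1 hc with rfl | hcs
  · rw [h.t_symm]
    exact h.isNormal_t_mul_self ha hb hx
  exact h.isNormal_t_mul_of_mem ha hbs hcs hx

theorem isNormal_r_mul_r_mul {w : M} (ha : a ∉ s) (hb : b ∈ insert a s) (hc : c ∈ insert a s)
    (hi : i ∈ insert a s) (hw : w ∈ words t r s) : IsNormal t r a s (r b c * (r a i * w)) := by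
  rcases Finset.mem_insert.1 hb with rfl | hbs
  · by_cases hbi : b = i
    · rw [← hbi, h.r_self, one_mul]
      exact h.isNormal_r_mul hc hw
    · rw [← mul_assoc, h.r_absorb _ hbi]
      exact h.isNormal_r_mul hi hw
  have hab : a ≠ b := fun e => ha (e ▸ hbs)
  rcases Finset.mem_insert.1 hc with rfl | hcs
  · by_cases hci : c = i
    · rw [← hci, h.r_self, one_mul, ← h.t_mul_r_self, mul_assoc]
      exact ⟨b, hb, b, hb, w, hw, rfl⟩
    · rw [← mul_assoc, h.r_mul_r _ hci, mul_assoc]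
      exact h.isNormal_t_mul ha hb (Finset.mem_insert_self c s) (h.isNormal_r_mul hi hw)
  have hac : a ≠ c := fun e => ha (e ▸ hcs)
  have hw' : r b c * w ∈ words t r s := mul_mem (r_mem_words hbs hcs) hw
  by_cases hib : i = b
  · rw [hib, ← mul_assoc, h.r_chain hab hac, mul_assoc]
    exact h.isNormal_r_mul hc hw'
  · rw [← mul_assoc, h.r_comm hab hac hib, mul_assoc]
    exact h.isNormal_r_mul hi hw'

theorem isNormal_of_mem_words {x : M} (ha : a ∉ s) (hx : x ∈ words t r (insert a s)) :
    IsNormal t r a s x := by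
  have haa : a ∈ insert a s := Finset.mem_insert_self a s
  induction hx using Submonoid.closure_induction_left with
  | one => simpa only [h.r_self, one_mul] using h.isNormal_r_mul haa (one_mem (words t r s))
  | mul_left g hg y _ ih =>
    obtain ⟨b, hb, c, hc, rfl | rfl⟩ := hg
    · exact h.isNormal_t_mul ha hb hc ih
    obtain ⟨j, hj, i, hi, w, hw, rfl⟩ := ih
    have hconj : r b c * t a j = t a j * r (Equiv.swap a j b) (Equiv.swap a j c) := by
      rw [h.t_mul_r, Equiv.swap_apply_self, Equiv.swap_apply_self]
    rw [← mul_assoc, hconj, mul_assoc]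
    exact h.isNormal_t_mul ha haa hj (h.isNormal_r_mul_r_mul ha
      (swap_mem haa hj hb) (swap_mem haa hj hc) hi hw)

end TransformationRelations

section Evaluation

variable {π : M →* Function.End α}

namespace IsEvaluation

variable (hπ : IsEvaluation t r π)
include hπ

theorem map_words_eq (s : Finset α) : (words t r s).map π = words swapMap replMap s := by
  rw [map_words, funext₂ hπ.map_t, funext₂ hπ.map_r]

theorem mem_selfMapsOn {w : M} (hw : w ∈ words t r s) : π w ∈ selfMapsOn s :=
  words_swapMap_replMap_le s (hπ.map_words_eq s ▸ Submonoid.mem_map_of_mem π hw)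

theorem map_t_mul_apply (a b : α) (w : M) (c : α) :
    π (t a b * w) c = Equiv.swap a b (π w c) := by
  rw [map_mul, hπ.map_t]; rfl

theorem map_r_mul_apply (a b : α) (w : M) (c : α) :
    π (r a b * w) c = if π w c = a then b else π w c := by
  rw [map_mul, hπ.map_r]; rfl

theorem r_mul_eq_self {w : M} (ih : Set.InjOn π (words t r s)) (hw : w ∈ words t r s)
    (hj : j ∈ s) (hmiss : ∀ c, π w c ≠ j) : r j (π w j) * w = w := by
  refine ih (mul_mem (r_mem_words hj ((hπ.mem_selfMapsOn hw).1 hj)) hw) hw (funext fun c => ?_)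
  rw [hπ.map_r_mul_apply, if_neg (hmiss c)]

end IsEvaluation

namespace TransformationRelations

variable (h : TransformationRelations t r) (hπ : IsEvaluation t r π)
include h hπ

/-- If `w` misses `j`, then `w = [j|k] w` with `k ≠ j`, and the relations turn a transposition
`[a, j]` before `[j|k]` into the replacement `[a|j]`. -/
theorem t_mul_r_mul_eq {w : M} (ih : Set.InjOn π (words t r s)) (ha : a ∉ s)
    (hw : w ∈ words t r s) (hj : j ∈ s) (hij : i ≠ j) (hmiss : ∀ c, π w c ≠ j) :
    t a j * (r a i * w) = r a j * (r a i * w) := by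
  have hws := hπ.mem_selfMapsOn hw
  have hwj : r j (π w j) * w = w := hπ.r_mul_eq_self ih hw hj hmiss
  have hja : j ≠ a := fun e => ha (e ▸ hj)
  have hka : π w j ≠ a := fun e => ha (e ▸ hws.1 hj)
  have hpull : r j (π w j) * (r a i * w) = r a i * w := by
    rw [← mul_assoc, ← h.r_comm hja hij.symm hka, mul_assoc, hwj]
  rw [← hpull, ← mul_assoc, ← h.r_mul_r a (hmiss j).symm, mul_assoc]

theorem exists_eq_r_mul_of_miss {x : M} (ih : Set.InjOn π (words t r s)) (ha : a ∉ s)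
    (hx : x ∈ words t r (insert a s)) (hmiss : ∀ c, π x c ≠ a) :
    ∃ i ∈ s, ∃ w ∈ words t r s, x = r a i * w := by
  obtain ⟨j, hj, i, hi, w, hw, rfl⟩ := h.isNormal_of_mem_words ha hx
  have hws := hπ.mem_selfMapsOn hw
  have hvalue (c : α) : (if π w c = a then i else π w c) ≠ j := by
    rw [← hπ.map_r_mul_apply]
    intro e
    exact hmiss c (by rw [hπ.map_t_mul_apply, e, Equiv.swap_apply_right])
  have hij : i ≠ j := by simpa only [hws.2 a ha, if_true] using hvalue a
  rcases Finset.mem_insert.1 hj with rfl | hjs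
  · exact ⟨i, Finset.mem_of_mem_insert_of_ne hi hij, w, hw, by rw [h.t_self, one_mul]⟩
  have hwj (c : α) : π w c ≠ j := fun e =>
    hvalue c (by rw [e, if_neg fun e' : j = a => ha (e' ▸ hjs)])
  rw [h.t_mul_r_mul_eq hπ ih ha hw hjs hij hwj]
  by_cases hai : a = i
  · exact ⟨j, hjs, w, hw, by rw [← hai, h.r_self, one_mul]⟩
  · exact ⟨i, Finset.mem_of_mem_insert_of_ne hi (Ne.symm hai), w, hw,
      by rw [← mul_assoc, h.r_absorb j hai]⟩

theorem eq_of_miss {x y : M} (ih : Set.InjOn π (words t r s)) (ha : a ∉ s)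
    (hx : x ∈ words t r (insert a s)) (hy : y ∈ words t r (insert a s)) (hxy : π x = π y)
    (hmiss : ∀ c, π x c ≠ a) : x = y := by
  obtain ⟨i, -, w, hw, rfl⟩ := h.exists_eq_r_mul_of_miss hπ ih ha hx hmiss
  obtain ⟨i', -, w', hw', rfl⟩ := h.exists_eq_r_mul_of_miss hπ ih ha hy (hxy ▸ hmiss)
  have hws := hπ.mem_selfMapsOn hw
  have hws' := hπ.mem_selfMapsOn hw'
  have hvalue (c : α) :
      (if π w c = a then i else π w c) = if π w' c = a then i' else π w' c := by
    rw [← hπ.map_r_mul_apply, ← hπ.map_r_mul_apply, hxy]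
  have hii : i = i' := by simpa only [hws.2 a ha, hws'.2 a ha, if_true] using hvalue a
  have hww : w = w' := by
    refine ih hw hw' (funext fun c => ?_)
    by_cases hc : c ∈ s
    · have hca : π w c ≠ a := fun e => ha (e ▸ hws.1 hc)
      have hca' : π w' c ≠ a := fun e => ha (e ▸ hws'.1 hc)
      simpa only [if_neg hca, if_neg hca'] using hvalue c
    · rw [hws.2 c hc, hws'.2 c hc]
  rw [hii, hww]

theorem exists_eq_t_mul_of_surjective {x : M} (ha : a ∉ s) (hx : x ∈ words t r (insert a s))
    (hsurj : Function.Surjective (π x)) : ∃ w ∈ words t r s, x = t a (π x a) * w := by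
  obtain ⟨j, -, i, -, w, hw, rfl⟩ := h.isNormal_of_mem_words ha hx
  have hwa : π w a = a := (hπ.mem_selfMapsOn hw).2 a ha
  have hia : i = a := by
    by_contra hia
    obtain ⟨c, hc⟩ := hsurj j
    rw [hπ.map_t_mul_apply, hπ.map_r_mul_apply, Equiv.swap_apply_eq_iff,
      Equiv.swap_apply_right] at hc
    grind
  refine ⟨w, hw, ?_⟩
  rw [hπ.map_t_mul_apply, hπ.map_r_mul_apply, hwa, if_pos rfl, hia, Equiv.swap_apply_left,
    h.r_self, one_mul]

theorem eq_of_surjective {x y : M} (ih : Set.InjOn π (words t r s)) (ha : a ∉ s)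
    (hx : x ∈ words t r (insert a s)) (hy : y ∈ words t r (insert a s)) (hxy : π x = π y)
    (hsurj : Function.Surjective (π x)) : x = y := by
  obtain ⟨w, hw, hxw⟩ := h.exists_eq_t_mul_of_surjective hπ ha hx hsurj
  obtain ⟨w', hw', hyw⟩ := h.exists_eq_t_mul_of_surjective hπ ha hy (hxy ▸ hsurj)
  rw [← hxy] at hyw
  have hww : w = w' := by
    refine ih hw hw' ?_
    rw [← h.t_mul_t_mul a (π x a) w, ← h.t_mul_t_mul a (π x a) w', ← hxw, ← hyw, map_mul, hxy,
      map_mul]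
  rw [hxw, hyw, hww]

theorem injOn_words (s : Finset α) : Set.InjOn π (words t r s) := by
  induction s using Finset.induction_on with
  | empty =>
    have hbot : words t r ∅ = ⊥ := by simp [words]
    rw [hbot]
    exact Set.injOn_singleton π 1
  | insert a s ha ih =>
    intro x hx y hy hxy
    by_cases hsurj : Function.Surjective (π x)
    · exact h.eq_of_surjective hπ ih ha hx hy hxy hsurj
    obtain ⟨j, hj⟩ : ∃ j, ∀ c, π x c ≠ j := by
      simpa only [Function.Surjective, not_forall, not_exists] using hsurj
    have hjs : j ∈ insert a s :=
      by_contra fun hjs => hj j ((hπ.mem_selfMapsOn hx).2 j hjs)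
    have ht : t a j ∈ words t r (insert a s) := t_mem_words (Finset.mem_insert_self a s) hjs
    have hmiss (c : α) : π (t a j * x) c ≠ a := by
      rw [hπ.map_t_mul_apply, Ne, Equiv.swap_apply_eq_iff, Equiv.swap_apply_left]
      exact hj c
    have htxy : t a j * x = t a j * y :=
      h.eq_of_miss hπ ih ha (mul_mem ht hx) (mul_mem ht hy)
        (by rw [map_mul, map_mul, hxy]) hmiss
    rw [← h.t_mul_t_mul a j x, htxy, h.t_mul_t_mul]

end TransformationRelations

end Evaluation

/-- The pairs `(w, f)` of a word `w` in the elements `t a b`, `r a b` and the self-map `f` of `α`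
that it denotes. -/
def wordGraph [Fintype α] (t r : α → α → M) : Submonoid (M × Function.End α) :=
  words (fun a b => (t a b, swapMap a b)) (fun a b => (r a b, replMap a b)) Finset.univ

namespace TransformationRelations

variable [Fintype α] (h : TransformationRelations t r)
include h

theorem bijective_snd_wordGraph :
    Function.Bijective ((MonoidHom.snd M (Function.End α)).comp (wordGraph t r).subtype) := by
  have hπ : IsEvaluation (fun a b => (t a b, swapMap a b)) (fun a b => (r a b, replMap a b))
      (MonoidHom.snd M (Function.End α)) := ⟨fun _ _ => rfl, fun _ _ => rfl⟩
  refine ⟨fun x y hxy => Subtype.ext <| (h.prod transformationRelations_swapMap_replMap).injOn_words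
    hπ Finset.univ x.2 y.2 hxy, fun f => ?_⟩
  obtain ⟨x, hx, rfl⟩ : f ∈ (wordGraph t r).map (MonoidHom.snd M (Function.End α)) := by
    rw [wordGraph, hπ.map_words_eq, words_swapMap_replMap_univ]
    trivial
  exact ⟨⟨x, hx⟩, rfl⟩

/-- The homomorphism from the monoid of self-maps of `α` that is determined by its values on
transpositions and replacements. -/
noncomputable def lift : Function.End α →* M :=
  ((MonoidHom.fst M (Function.End α)).comp (wordGraph t r).subtype).comp
    (MulEquiv.ofBijective _ h.bijective_snd_wordGraph).symm.toMonoidHom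

theorem lift_eq {x : M} {f : Function.End α} (hx : (x, f) ∈ wordGraph t r) : h.lift f = x :=
  congrArg (fun z => z.1.1) <|
    (MulEquiv.ofBijective _ h.bijective_snd_wordGraph).symm_apply_apply ⟨(x, f), hx⟩

theorem lift_swapMap (a b : α) : h.lift (swapMap a b) = t a b :=
  h.lift_eq (t_mem_words (Finset.mem_univ a) (Finset.mem_univ b))

theorem lift_replMap (a b : α) : h.lift (replMap a b) = r a b :=
  h.lift_eq (r_mem_words (Finset.mem_univ a) (Finset.mem_univ b))

end TransformationRelations

end Transformations

section BooleanDuality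

open scoped SetFamily

variable {A B C : Type*} [BooleanAlgebra A] [BooleanAlgebra B] [BooleanAlgebra C]

/-- A map between Boolean algebras that preserves meets and complements, as a homomorphism. -/
def homOfInfCompl (f : A → B) (map_inf : ∀ x y, f (x ⊓ y) = f x ⊓ f y)
    (map_compl : ∀ x, f xᶜ = (f x)ᶜ) : BoundedLatticeHom A B :=
  have map_bot : f ⊥ = ⊥ := by rw [← inf_compl_self ⊥, map_inf, map_compl, inf_compl_self]
  { toFun := f
    map_sup' := fun x y => by
      rw [← compl_compl (x ⊔ y), compl_sup, map_compl, map_inf, map_compl, map_compl, compl_inf,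
        compl_compl, compl_compl]
    map_inf' := map_inf
    map_top' := by rw [← compl_bot, map_compl, map_bot, compl_bot]
    map_bot' := map_bot }

/-- A point of the dual space of `A`: an ultrafilter of `A`, encoded as a homomorphism into the
two-element Boolean algebra of propositions. -/
abbrev BooleanPoint (A : Type*) [BooleanAlgebra A] := BoundedLatticeHom A Prop

namespace BooleanPoint

theorem mono (P : BooleanPoint A) {x y : A} (hxy : x ≤ y) : P x → P y := OrderHomClass.mono P hxy

theorem apply_compl (P : BooleanPoint A) (x : A) : P xᶜ ↔ ¬ P x := by
  rw [map_compl']; rfl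

theorem exists_of_bot_notMem {S : Set A} (hne : S.Nonempty) (hinf : InfClosed S) (hbot : ⊥ ∉ S) :
    ∃ P : BooleanPoint A, ∀ x ∈ S, P x := by
  have hF : Order.IsPFilter (upperClosure S : Set A) := by
    refine .of_def (hne.mono subset_upperClosure) ?_ fun hxy hx => (upperClosure S).upper hxy hx
    rintro x ⟨x', hx', hxx'⟩ y ⟨y', hy', hyy'⟩
    exact ⟨x' ⊓ y', subset_upperClosure (hinf hx' hy'), inf_le_left.trans hxx',
      inf_le_right.trans hyy'⟩
  have hdisj : Disjoint (hF.toPFilter : Set A) (Order.Ideal.principal (⊥ : A)) := by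
    refine Set.disjoint_left.2 ?_
    rintro x ⟨y, hy, hyx⟩ hx
    exact hbot ((le_bot_iff.1 (hyx.trans hx)) ▸ hy)
  obtain ⟨J, hJ, -, hFJ⟩ := DistribLattice.prime_ideal_of_disjoint_filter_ideal hdisj
  have map_inf (x y : A) : (x ⊓ y ∉ J) = ((x ∉ J) ⊓ (y ∉ J)) := propext
    ⟨fun h => ⟨fun hx => h (J.lower inf_le_left hx), fun hy => h (J.lower inf_le_right hy)⟩,
      fun h hxy => (hJ.mem_or_mem hxy).elim h.1 h.2⟩
  have map_compl (x : A) : (xᶜ ∉ J) = (x ∉ J)ᶜ := propext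
    ⟨fun h hx => hJ.mem_or_compl_mem.elim hx h,
      fun h hx => h (hJ.toIsProper.notMem_of_compl_mem hx)⟩
  exact ⟨homOfInfCompl (fun x => x ∉ J) map_inf map_compl,
    fun x hx => Set.disjoint_left.1 hFJ (subset_upperClosure hx)⟩

theorem le_of_forall {x y : A} (h : ∀ P : BooleanPoint A, P x → P y) : x ≤ y := by
  by_contra hxy
  obtain ⟨P, hP⟩ := exists_of_bot_notMem (Set.singleton_nonempty (x ⊓ yᶜ)) infClosed_singleton
    fun hbot => hxy (disjoint_compl_right_iff.1 (disjoint_iff.2 hbot.symm))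
  have hPxy : P (x ⊓ yᶜ) := hP _ rfl
  rw [map_inf] at hPxy
  exact (P.apply_compl y).1 hPxy.2 (h P hPxy.1)

theorem ext_of_imp {P Q : BooleanPoint A} (h : ∀ x, P x → Q x) : P = Q :=
  DFunLike.ext _ _ fun x => propext ⟨h x, fun hQ => not_not.1 fun hP =>
    (Q.apply_compl x).1 (h _ ((P.apply_compl x).2 hP)) hQ⟩

theorem exists_comp_eq {p : BoundedLatticeHom A B} {W : BooleanPoint A} {b : B}
    (h : ∀ a, b ≤ p a → W a) : ∃ U : BooleanPoint B, U.comp p = W ∧ U b := by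
  have hne : ((fun a => b ⊓ p a) '' {a | W a}).Nonempty := ⟨_, ⊤, by simp, rfl⟩
  have hinf : InfClosed ((fun a => b ⊓ p a) '' {a | W a}) := by
    rintro _ ⟨x, hx, rfl⟩ _ ⟨y, hy, rfl⟩
    refine ⟨x ⊓ y, ?_, ?_⟩
    · change W (x ⊓ y)
      rw [map_inf]
      exact ⟨hx, hy⟩
    · rw [← inf_inf_distrib_left, ← map_inf]
  have hbot : ⊥ ∉ (fun a => b ⊓ p a) '' {a | W a} := by
    rintro ⟨x, hx, hbx⟩
    exact (W.apply_compl x).1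
      (h xᶜ (by rw [map_compl']; exact (disjoint_iff.2 hbx).le_compl_right)) hx
  obtain ⟨U, hU⟩ := exists_of_bot_notMem hne hinf hbot
  refine ⟨U, (ext_of_imp fun a ha => ?_).symm, U.mono inf_le_left (hU _ ⟨⊤, by simp, rfl⟩)⟩
  exact U.mono inf_le_right (hU _ ⟨a, ha, rfl⟩)

theorem exists_comp_eq_of_injective {p : BoundedLatticeHom A B} (hp : Function.Injective p)
    (W : BooleanPoint A) : ∃ U : BooleanPoint B, U.comp p = W := by
  obtain ⟨U, hU, -⟩ := exists_comp_eq (p := p) (W := W) (b := ⊤) fun a ha => by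
    rw [hp ((top_le_iff.1 ha).trans (map_top p).symm), map_top]
    trivial
  exact ⟨U, hU⟩

theorem exists_interpolant {p : BoundedLatticeHom A B} {q : BoundedLatticeHom A C} {b : B} {c : C}
    (h : ∀ (U : BooleanPoint B) (V : BooleanPoint C), U.comp p = V.comp q → U b → V c) :
    ∃ a, b ≤ p a ∧ q a ≤ c := by
  by_contra! hbc
  have hne : ({x | b ≤ p x} ⊼ {y | cᶜ ≤ q y}).Nonempty := ⟨_, ⊤, by simp, ⊤, by simp, rfl⟩
  have hinf : InfClosed ({x | b ≤ p x} ⊼ {y | cᶜ ≤ q y}) := by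
    rintro _ ⟨x, hx, y, hy, rfl⟩ _ ⟨x', hx', y', hy', rfl⟩
    exact ⟨x ⊓ x', (le_inf hx hx').trans_eq (map_inf p x x').symm, y ⊓ y',
      (le_inf hy hy').trans_eq (map_inf q y y').symm, inf_inf_inf_comm ..⟩
  have hbot : ⊥ ∉ {x | b ≤ p x} ⊼ {y | cᶜ ≤ q y} := by
    rintro ⟨x, hx, y, hy, hxy⟩
    have hdisj : Disjoint (q x) (q y) :=
      disjoint_iff.2 ((map_inf q x y).symm.trans ((congrArg q hxy).trans (map_bot q)))
    exact hbc x hx (disjoint_compl_right_iff.1 (hdisj.mono_right hy))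
  obtain ⟨W, hW⟩ := exists_of_bot_notMem hne hinf hbot
  obtain ⟨U, hUW, hUb⟩ := exists_comp_eq (p := p) (W := W) (b := b) fun a ha =>
    hW a ⟨a, ha, ⊤, by simp, inf_top_eq a⟩
  obtain ⟨V, hVW, hVc⟩ := exists_comp_eq (p := q) (W := W) (b := cᶜ) fun a ha =>
    hW a ⟨⊤, by simp, a, ha, top_inf_eq a⟩
  exact (V.apply_compl c).1 hVc (h U V (hUW.trans hVW.symm) hUb)

end BooleanPoint

section FiniteClosure

variable {ι : Type*} {g : ι → A}

theorem apply_iff_of_mem_closure {P Q : BooleanPoint A} (hPQ : P ∘ g = Q ∘ g) {a : A}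
    (ha : a ∈ BooleanSubalgebra.closure (Set.range g)) : P a ↔ Q a := by
  induction ha using BooleanSubalgebra.closure_bot_sup_induction with
  | mem x hx =>
    obtain ⟨i, rfl⟩ := hx
    exact iff_of_eq (congrFun hPQ i)
  | bot => rw [map_bot, map_bot]
  | sup x _ y _ hx hy => rw [map_sup, map_sup]; exact or_congr hx hy
  | compl x _ hx => rw [P.apply_compl, Q.apply_compl, hx]

/-- The disjunctive normal form of `a` in terms of the generators `g`: the set of the truth value
assignments to the generators that make `a` true. -/
def satisfyingAssignments (g : ι → A) (a : A) : Set (ι → Prop) :=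
  {v | ∃ P : BooleanPoint A, P a ∧ P ∘ g = v}

theorem injOn_satisfyingAssignments :
    Set.InjOn (satisfyingAssignments g) (BooleanSubalgebra.closure (Set.range g)) := by
  have le_of_eq {a b : A} (hb : b ∈ BooleanSubalgebra.closure (Set.range g))
      (hab : satisfyingAssignments g a = satisfyingAssignments g b) : a ≤ b :=
    BooleanPoint.le_of_forall fun P hP => by
      obtain ⟨Q, hQ, hQP⟩ : P ∘ g ∈ satisfyingAssignments g b := hab ▸ ⟨P, hP, rfl⟩
      exact (apply_iff_of_mem_closure hQP hb).1 hQ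
  exact fun a ha b hb hab => (le_of_eq hb hab).antisymm (le_of_eq ha hab.symm)

theorem finite_closure_range [Finite ι] :
    (BooleanSubalgebra.closure (Set.range g) : Set A).Finite :=
  .of_finite_image (Set.toFinite _) injOn_satisfyingAssignments

theorem ncard_closure_range_le [Finite ι] :
    (BooleanSubalgebra.closure (Set.range g) : Set A).ncard ≤ 2 ^ 2 ^ Nat.card ι := by
  rw [← injOn_satisfyingAssignments.ncard_image]
  refine (Set.ncard_le_card _).trans_eq ?_
  have := Fintype.ofFinite ι
  classical simp

end FiniteClosure

end BooleanDuality

section Operations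

variable {n : ℕ} {A : Type u} [BooleanAlgebra A]

instance : Monoid (BoundedLatticeHom A A) where
  mul f g := f.comp g
  one := BoundedLatticeHom.id A
  mul_assoc _ _ _ := rfl
  one_mul _ := rfl
  mul_one _ := rfl

theorem hom_mul_apply (f g : BoundedLatticeHom A A) (x : A) : (f * g) x = f (g x) := rfl

theorem hom_one_apply (x : A) : (1 : BoundedLatticeHom A A) x = x := rfl

variable [SA n A]

variable (A) in
/-- The operation `s_{ij}` as a Boolean endomorphism, with the convention that `s_{ii} x = x`. -/
def trHom (i j : Fin n) : BoundedLatticeHom A A :=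
  if h : i = j then 1 else homOfInfCompl (tr i j h) (tr_inf i j h) (tr_compl i j h)

variable (A) in
/-- The operation `s^i_j` as a Boolean endomorphism, with the convention that `s^i_i x = x`. -/
def rpHom (i j : Fin n) : BoundedLatticeHom A A :=
  if h : i = j then 1 else homOfInfCompl (rp i j h) (rp_inf i j h) (rp_compl i j h)

theorem trHom_apply {i j : Fin n} (h : i ≠ j) (x : A) : trHom A i j x = tr i j h x := by
  rw [trHom, dif_neg h]; rfl

theorem rpHom_apply {i j : Fin n} (h : i ≠ j) (x : A) : rpHom A i j x = rp i j h x := by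
  rw [rpHom, dif_neg h]; rfl

theorem trHom_self (i : Fin n) : trHom A i i = 1 := dif_pos rfl

theorem rpHom_self (i : Fin n) : rpHom A i i = 1 := dif_pos rfl

theorem trHom_symm (i j : Fin n) : trHom A i j = trHom A j i := by
  by_cases h : i = j
  · rw [h]
  · ext x
    rw [trHom_apply h, trHom_apply (Ne.symm h), tr_symm]

theorem trHom_mul_self (i j : Fin n) : trHom A i j * trHom A i j = 1 := by
  by_cases h : i = j
  · rw [h, trHom_self, one_mul]
  · ext x
    rw [hom_mul_apply, trHom_apply h, trHom_apply h, tr_tr, hom_one_apply]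

theorem trHom_mul_eq {i j : Fin n} {f g : BoundedLatticeHom A A}
    (h : ∀ x, trHom A i j (f (trHom A i j x)) = g x) : trHom A i j * f = g * trHom A i j := by
  have hconj : trHom A i j * f * trHom A i j = g := DFunLike.ext _ _ h
  rw [← hconj, mul_assoc _ (trHom A i j), trHom_mul_self, mul_one]

theorem trHom_mul_trHom (a b c d : Fin n) :
    trHom A a b * trHom A c d =
      trHom A (Equiv.swap a b c) (Equiv.swap a b d) * trHom A a b := by
  have hconj {i j k : Fin n} (hij : i ≠ j) (hjk : j ≠ k) (hik : i ≠ k) :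
      trHom A i j * trHom A j k = trHom A i k * trHom A i j :=
    trHom_mul_eq fun x => by simp only [trHom_apply, *, ne_eq, not_false_eq_true, tr_conj]
  have hcomm {i j k l : Fin n} (hij : i ≠ j) (hik : i ≠ k) (hil : i ≠ l) (hjk : j ≠ k)
      (hjl : j ≠ l) (hkl : k ≠ l) : trHom A i j * trHom A k l = trHom A k l * trHom A i j :=
    DFunLike.ext _ _ fun x => by
      simpa only [hom_mul_apply, trHom_apply hij, trHom_apply hkl] using
        tr_comm i j k l hij hik hil hjk hjl hkl x
  rw [Equiv.swap_apply_def, Equiv.swap_apply_def]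
  grind [trHom_self (A := A) (n := n), trHom_symm, one_mul, mul_one]

theorem rpHom_mul_trHom (a b : Fin n) : rpHom A a b * trHom A a b = rpHom A a b := by
  by_cases h : a = b
  · rw [h, trHom_self, mul_one]
  · ext x
    rw [hom_mul_apply, trHom_symm, trHom_apply (Ne.symm h), rpHom_apply h, rpHom_apply h, rp_tr]

theorem trHom_mul_rpHom (a b c d : Fin n) :
    trHom A a b * rpHom A c d =
      rpHom A (Equiv.swap a b c) (Equiv.swap a b d) * trHom A a b := by
  have hdisj {i j k l : Fin n} (hij : i ≠ j) (hik : i ≠ k) (hil : i ≠ l) (hjk : j ≠ k)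
      (hjl : j ≠ l) (hkl : k ≠ l) : trHom A k l * rpHom A j i = rpHom A j i * trHom A k l :=
    trHom_mul_eq fun x => by
      simpa only [trHom_apply hkl, rpHom_apply hij.symm] using
        conj_disjoint i j k l hij hik hil hjk hjl hkl x
  have hsource {i j k : Fin n} (hij : i ≠ j) (hjk : j ≠ k) (hik : i ≠ k) :
      trHom A j k * rpHom A j i = rpHom A k i * trHom A j k :=
    trHom_mul_eq fun x => by
      simpa only [trHom_apply hjk, rpHom_apply hij.symm, rpHom_apply hik.symm] using
        conj_source i j k hij hjk hik x
  have htarget {i j k : Fin n} (hij : i ≠ j) (hjk : j ≠ k) (hik : i ≠ k) :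
      trHom A k i * rpHom A j i = rpHom A j k * trHom A k i :=
    trHom_mul_eq fun x => by
      simpa only [trHom_apply hik.symm, rpHom_apply hij.symm, rpHom_apply hjk] using
        conj_target i j k hij hjk hik x
  have hswap {i j : Fin n} (hij : i ≠ j) :
      trHom A i j * rpHom A j i = rpHom A i j * trHom A i j :=
    trHom_mul_eq fun x => by
      simpa only [trHom_apply hij, rpHom_apply hij, rpHom_apply hij.symm] using conj_swap i j hij x
  rw [Equiv.swap_apply_def, Equiv.swap_apply_def]
  grind [trHom_self (A := A) (n := n), rpHom_self (A := A) (n := n), trHom_symm, one_mul, mul_one]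

theorem trHom_mul_rpHom_self (a b : Fin n) : trHom A a b * rpHom A a b = rpHom A b a := by
  rw [trHom_mul_rpHom, Equiv.swap_apply_left, Equiv.swap_apply_right, trHom_symm, rpHom_mul_trHom]

theorem rpHom_comm {a b c d : Fin n} (hca : c ≠ a) (hcb : c ≠ b) (hda : d ≠ a) :
    rpHom A a b * rpHom A c d = rpHom A c d * rpHom A a b := by
  by_cases hab : a = b
  · rw [hab, rpHom_self, one_mul, mul_one]
  by_cases hcd : c = d
  · rw [hcd, rpHom_self, one_mul, mul_one]
  ext x
  simp only [hom_mul_apply, rpHom_apply hab, rpHom_apply hcd]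
  by_cases hdb : d = b
  · subst hdb
    exact rp_comm_target d a c hda hca.symm hcb.symm x
  · exact rp_comm b a c d (Ne.symm hab) hcb.symm (Ne.symm hdb) hca.symm hda.symm hcd x

theorem rpHom_chain {a b c : Fin n} (hab : a ≠ b) (hac : a ≠ c) :
    rpHom A b c * rpHom A a b = rpHom A a c * rpHom A b c := by
  by_cases hbc : b = c
  · rw [hbc, rpHom_self, one_mul, mul_one]
  ext x
  simp only [hom_mul_apply, rpHom_apply hab, rpHom_apply hbc, rpHom_apply hac]
  exact (rp_chain c b a (Ne.symm hbc) hab.symm hac.symm x).symm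

theorem rpHom_absorb {a b : Fin n} (c : Fin n) (hab : a ≠ b) :
    rpHom A a c * rpHom A a b = rpHom A a b := by
  by_cases hac : a = c
  · rw [hac, rpHom_self, one_mul]
  ext x
  simp only [hom_mul_apply, rpHom_apply hac, rpHom_apply hab]
  by_cases hcb : c = b
  · subst hcb
    exact rp_idem c a hab.symm x
  · exact rp_absorb c a b (Ne.symm hac) hab hcb x

theorem rpHom_mul_rpHom (a : Fin n) {b c : Fin n} (hbc : b ≠ c) :
    rpHom A a b * rpHom A b c = trHom A a b * rpHom A b c := by
  by_cases hab : a = b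
  · rw [hab, rpHom_self, trHom_self]
  by_cases hca : c = a
  · subst hca
    rw [trHom_symm, trHom_mul_rpHom_self]
    ext x
    simpa only [hom_mul_apply, rpHom_apply hab, rpHom_apply hbc] using rp_rp_swap b c hbc x
  · rw [trHom_mul_rpHom, Equiv.swap_apply_right, Equiv.swap_apply_of_ne_of_ne hca hbc.symm,
      trHom_symm]
    ext x
    simpa only [hom_mul_apply, rpHom_apply hab, rpHom_apply hbc, rpHom_apply (Ne.symm hca),
      trHom_apply (Ne.symm hab)] using rp_rp_eq_rp_tr b a c (Ne.symm hab) (Ne.symm hca) hbc x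

variable (n A) in
theorem transformationRelations_trHom_rpHom :
    TransformationRelations (trHom (n := n) A) (rpHom A) where
  t_self := trHom_self
  r_self := rpHom_self
  t_mul_t_self := trHom_mul_self
  t_mul_t := trHom_mul_trHom
  t_mul_r := trHom_mul_rpHom
  t_mul_r_self := trHom_mul_rpHom_self
  r_comm := rpHom_comm
  r_chain := rpHom_chain
  r_absorb := rpHom_absorb
  r_mul_r := rpHom_mul_rpHom

variable (n A) in
/-- The operation `s_τ` on `A` for an arbitrary self-map `τ` of `Fin n`, as a Boolean
endomorphism; it satisfies `s_σ s_τ = s_{σ ∘ τ}`. -/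
noncomputable def substitution : Function.End (Fin n) →* BoundedLatticeHom A A :=
  (transformationRelations_trHom_rpHom n A).lift

theorem substitution_swapMap {i j : Fin n} (h : i ≠ j) (x : A) :
    substitution n A (swapMap i j) x = tr i j h x := by
  rw [substitution, TransformationRelations.lift_swapMap, trHom_apply h]

theorem substitution_replMap {i j : Fin n} (h : i ≠ j) (x : A) :
    substitution n A (replMap i j) x = rp i j h x := by
  rw [substitution, TransformationRelations.lift_replMap, rpHom_apply h]

end Operations

section LocallyFinite

variable {n : ℕ} {A : Type u} [BooleanAlgebra A] [SA n A]

theorem isSubalgebra_of_substitution_mem {S : BooleanSubalgebra A}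
    (hS : ∀ τ, ∀ x ∈ S, substitution n A τ x ∈ S) : IsSubalgebra n (S : Set A) where
  bot_mem := S.bot_mem
  inf_mem _ hx _ hy := S.inf_mem hx hy
  compl_mem _ hx := S.compl_mem hx
  tr_mem i j h x hx := substitution_swapMap h x ▸ hS (swapMap i j) x hx
  rp_mem i j h x hx := substitution_replMap h x ▸ hS (replMap i j) x hx

variable (n) in
/-- The elements `s_τ x` for `x ∈ X` and `τ` a self-map of `Fin n`. -/
noncomputable def substitutionOrbit (X : Set A) (z : X × Function.End (Fin n)) : A :=
  substitution n A z.2 z.1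

theorem subset_range_substitutionOrbit (X : Set A) : X ⊆ Set.range (substitutionOrbit n X) :=
  fun x hx => ⟨(⟨x, hx⟩, 1), by rw [substitutionOrbit, map_one, hom_one_apply]⟩

theorem substitution_mem_closure_substitutionOrbit (X : Set A) (σ : Function.End (Fin n)) {x : A}
    (hx : x ∈ BooleanSubalgebra.closure (Set.range (substitutionOrbit n X))) :
    substitution n A σ x ∈ BooleanSubalgebra.closure (Set.range (substitutionOrbit n X)) := by
  induction hx using BooleanSubalgebra.closure_bot_sup_induction with
  | mem x hx =>
    obtain ⟨⟨x, τ⟩, rfl⟩ := hx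
    refine BooleanSubalgebra.subset_closure ⟨⟨x, σ * τ⟩, ?_⟩
    rw [substitutionOrbit, map_mul, hom_mul_apply, substitutionOrbit]
  | bot => rw [map_bot]; exact BooleanSubalgebra.bot_mem
  | sup x _ y _ hx hy => rw [map_sup]; exact BooleanSubalgebra.sup_mem hx hy
  | compl x _ hx => rw [map_compl']; exact BooleanSubalgebra.compl_mem hx

theorem Sg_subset_closure_substitutionOrbit (X : Set A) :
    Sg n X ⊆ BooleanSubalgebra.closure (Set.range (substitutionOrbit n X)) :=
  Set.sInter_subset_of_mem
    ⟨isSubalgebra_of_substitution_mem fun σ _ => substitution_mem_closure_substitutionOrbit X σ,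
      (subset_range_substitutionOrbit X).trans BooleanSubalgebra.subset_closure⟩

theorem finite_Sg {X : Set A} (hX : X.Finite) : (Sg n X).Finite :=
  have := hX.to_subtype
  have : Finite (Function.End (Fin n)) := inferInstanceAs (Finite (Fin n → Fin n))
  finite_closure_range.subset (Sg_subset_closure_substitutionOrbit X)

theorem card_Sg_le {X : Set A} (hX : X.Finite) :
    Nat.card (Sg n X) ≤ 2 ^ 2 ^ (Nat.card X * n ^ n) := by
  have := hX.to_subtype
  have : Finite (Function.End (Fin n)) := inferInstanceAs (Finite (Fin n → Fin n))
  have card_end : Nat.card (Function.End (Fin n)) = n ^ n := by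
    change Nat.card (Fin n → Fin n) = n ^ n
    simp
  calc (Sg n X).ncard
    _ ≤ (BooleanSubalgebra.closure (Set.range (substitutionOrbit n X)) : Set A).ncard :=
        Set.ncard_le_ncard (Sg_subset_closure_substitutionOrbit X) finite_closure_range
    _ ≤ 2 ^ 2 ^ Nat.card (X × Function.End (Fin n)) := ncard_closure_range_le
    _ = 2 ^ 2 ^ (Nat.card X * n ^ n) := by rw [Nat.card_prod, card_end]

end LocallyFinite

section Homomorphisms

variable {n : ℕ} {A B : Type*} [BooleanAlgebra A] [BooleanAlgebra B]

/-- The substitution algebra given by an action of the monoid of self-maps of `Fin n` on a Boolean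
algebra by endomorphisms. -/
abbrev ofHom (ρ : Function.End (Fin n) →* BoundedLatticeHom A A) : SA n A := by
  apply SA.mk (tr := fun i j _ => ρ (swapMap i j)) (rp := fun i j _ => ρ (replMap i j))
  case tr_inf | rp_inf => exact fun i j _ => map_inf _
  case tr_compl | rp_compl => exact fun i j _ => map_compl' _
  case tr_symm =>
    intro i j _ x
    rw [transformationRelations_swapMap_replMap.t_symm]
  case tr_tr =>
    intro i j _ x
    rw [← hom_mul_apply, ← map_mul, transformationRelations_swapMap_replMap.t_mul_t_self, map_one,
      hom_one_apply]
  all_goals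
    intros
    simp only [← hom_mul_apply, ← map_mul]
    congr 2
    funext x
    simp only [swapMap, replMap, end_mul_apply, Equiv.swap_apply_def]
    grind

variable [SA n A] [SA n B]

/-- A monomorphism of substitution algebras as a homomorphism of Boolean algebras. -/
def IsMono.toHom {f : A → B} (hf : IsMono n f) : BoundedLatticeHom A B :=
  homOfInfCompl f hf.map_inf hf.map_compl

variable (n) in
/-- The map `f` commutes with the operations `s_τ` for all self-maps `τ` of `Fin n`. -/
def IsEquivariant (f : A → B) : Prop :=
  ∀ (τ : Function.End (Fin n)) (x : A), f (substitution n A τ x) = substitution n B τ (f x)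

theorem IsMono.isEquivariant {f : A → B} (hf : IsMono n f) : IsEquivariant n f := by
  intro τ x
  have hτ : τ ∈ words swapMap replMap Finset.univ := by
    rw [words_swapMap_replMap_univ]
    trivial
  induction hτ using Submonoid.closure_induction generalizing x with
  | one => rw [map_one, map_one, hom_one_apply, hom_one_apply]
  | mul σ τ _ _ hσ hτ => rw [map_mul, map_mul, hom_mul_apply, hom_mul_apply, hσ, hτ]
  | mem τ hτ =>
    obtain ⟨i, -, j, -, rfl | rfl⟩ := hτ <;> by_cases h : i = j
    · rw [h, transformationRelations_swapMap_replMap.t_self, map_one, map_one]; rfl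
    · rw [substitution_swapMap h, substitution_swapMap h, hf.map_tr]
    · rw [h, transformationRelations_swapMap_replMap.r_self, map_one, map_one]; rfl
    · rw [substitution_replMap h, substitution_replMap h, hf.map_rp]

end Homomorphisms

section Amalgamation

variable {n : ℕ} {A B C : Type*} [BooleanAlgebra A] [BooleanAlgebra B] [BooleanAlgebra C]

/-- The pullback of the dual spaces of `B` and `C` over that of `A`: the dual space of the
amalgamated sum of Boolean algebras. -/
def Pullback (p : BoundedLatticeHom A B) (q : BoundedLatticeHom A C) :=
  {z : BooleanPoint B × BooleanPoint C // z.1.comp p = z.2.comp q}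

namespace Pullback

variable {p : BoundedLatticeHom A B} {q : BoundedLatticeHom A C}

variable (p q) in
/-- The canonical map from `B` to the amalgam `Set (Pullback p q)`. -/
def inl (b : B) : Set (Pullback p q) := {z | z.1.1 b}

variable (p q) in
/-- The canonical map from `C` to the amalgam `Set (Pullback p q)`. -/
def inr (c : C) : Set (Pullback p q) := {z | z.1.2 c}

theorem inl_comp_eq (a : A) : inl p q (p a) = inr p q (q a) :=
  Set.ext fun z => iff_of_eq (DFunLike.congr_fun z.2 a)

theorem exists_of_inl_le_inr {b : B} {c : C} (h : inl p q b ≤ inr p q c) :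
    ∃ a, b ≤ p a ∧ q a ≤ c :=
  BooleanPoint.exists_interpolant fun U V hUV hU => h (a := ⟨(U, V), hUV⟩) hU

theorem exists_of_inr_le_inl {b : B} {c : C} (h : inr p q c ≤ inl p q b) :
    ∃ a, c ≤ q a ∧ p a ≤ b :=
  BooleanPoint.exists_interpolant fun V U hVU hV => h (a := ⟨(U, V), hVU.symm⟩) hV

theorem inl_injective (hq : Function.Injective q) : Function.Injective (inl p q) := by
  have le_of_eq {b b' : B} (h : inl p q b = inl p q b') : b ≤ b' :=
    BooleanPoint.le_of_forall fun U hU => by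
      obtain ⟨V, hV⟩ := BooleanPoint.exists_comp_eq_of_injective hq (U.comp p)
      exact (Set.ext_iff.1 h ⟨(U, V), hV.symm⟩).1 hU
  exact fun b b' h => (le_of_eq h).antisymm (le_of_eq h.symm)

theorem inr_injective (hp : Function.Injective p) : Function.Injective (inr p q) := by
  have le_of_eq {c c' : C} (h : inr p q c = inr p q c') : c ≤ c' :=
    BooleanPoint.le_of_forall fun V hV => by
      obtain ⟨U, hU⟩ := BooleanPoint.exists_comp_eq_of_injective hp (V.comp q)
      exact (Set.ext_iff.1 h ⟨(U, V), hU⟩).1 hV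
  exact fun c c' h => (le_of_eq h).antisymm (le_of_eq h.symm)

variable [SA n A] [SA n B] [SA n C]

/-- The action of a self-map of `Fin n` on the points of the pullback, dual to the operation
`s_τ`. -/
noncomputable def act (hp : IsEquivariant n p) (hq : IsEquivariant n q) (τ : Function.End (Fin n))
    (z : Pullback p q) : Pullback p q :=
  ⟨(z.1.1.comp (substitution n B τ), z.1.2.comp (substitution n C τ)), by
    ext a
    change z.1.1 (substitution n B τ (p a)) ↔ z.1.2 (substitution n C τ (q a))
    rw [← hp, ← hq]
    exact iff_of_eq (DFunLike.congr_fun z.2 (substitution n A τ a))⟩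

/-- The action of the self-maps of `Fin n` on the sets of points of the pullback. -/
noncomputable def substitutionHom (hp : IsEquivariant n p) (hq : IsEquivariant n q) :
    Function.End (Fin n) →* BoundedLatticeHom (Set (Pullback p q)) (Set (Pullback p q)) where
  toFun τ := (CompleteLatticeHom.setPreimage (act hp hq τ)).toBoundedLatticeHom
  map_one' := by
    have act_one (z : Pullback p q) : act hp hq 1 z = z := by
      rw [act]; simp only [map_one]; rfl
    ext Y z
    exact iff_of_eq (congrArg (· ∈ Y) (act_one z))
  map_mul' σ τ := by
    have act_mul (z : Pullback p q) : act hp hq (σ * τ) z = act hp hq τ (act hp hq σ z) := by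
      simp only [act, map_mul]; rfl
    ext Y z
    exact iff_of_eq (congrArg (· ∈ Y) (act_mul z))

/-- The amalgam of `B` and `C` over `A`. -/
noncomputable abbrev amalgam (hp : IsEquivariant n p) (hq : IsEquivariant n q) :
    SA n (Set (Pullback p q)) :=
  ofHom (substitutionHom hp hq)

theorem isMono_inl (hp : IsEquivariant n p) (hq : IsEquivariant n q) (hinj : Function.Injective q) :
    letI := amalgam hp hq
    IsMono n (inl p q) :=
  letI := amalgam hp hq
  { injective := inl_injective hinj
    map_inf := fun b b' => Set.ext fun z => iff_of_eq (map_inf z.1.1 b b')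
    map_compl := fun b => Set.ext fun z => z.1.1.apply_compl b
    map_tr := fun _ _ h b => Set.ext fun z =>
      iff_of_eq (congrArg z.1.1 (substitution_swapMap h b).symm)
    map_rp := fun _ _ h b => Set.ext fun z =>
      iff_of_eq (congrArg z.1.1 (substitution_replMap h b).symm) }

theorem isMono_inr (hp : IsEquivariant n p) (hq : IsEquivariant n q) (hinj : Function.Injective p) :
    letI := amalgam hp hq
    IsMono n (inr p q) :=
  letI := amalgam hp hq
  { injective := inr_injective hinj
    map_inf := fun c c' => Set.ext fun z => iff_of_eq (map_inf z.1.2 c c')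
    map_compl := fun c => Set.ext fun z => z.1.2.apply_compl c
    map_tr := fun _ _ h c => Set.ext fun z =>
      iff_of_eq (congrArg z.1.2 (substitution_swapMap h c).symm)
    map_rp := fun _ _ h c => Set.ext fun z =>
      iff_of_eq (congrArg z.1.2 (substitution_replMap h c).symm) }

end Pullback

theorem superAmalgamation (n : ℕ) : SuperAmalgamation.{u} n := by
  intro A B C _ _ _ _ _ _ p q hp hq
  exact ⟨Set (Pullback hp.toHom hq.toHom), inferInstance,
    Pullback.amalgam (p := hp.toHom) (q := hq.toHom) hp.isEquivariant hq.isEquivariant,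
    Pullback.inl hp.toHom hq.toHom, Pullback.inr hp.toHom hq.toHom,
    Pullback.isMono_inl _ _ hq.injective, Pullback.isMono_inr _ _ hp.injective,
    Pullback.inl_comp_eq, fun _ _ => Pullback.exists_of_inl_le_inr,
    fun _ _ => Pullback.exists_of_inr_le_inl⟩

end Amalgamation

end SA

theorem mainTheorem4 (n : ℕ) :
    SA.LocallyFinite.{u} n ∧
    (∀ (A : Type u) [BooleanAlgebra A] [SA n A] (m : ℕ) (X : Finset A), X.card = m →
      SA.Sg n (X : Set A) = Set.univ → Finite A ∧ Nat.card A ≤ 2 ^ 2 ^ (m * n ^ n)) ∧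
    SA.SuperAmalgamation.{u} n := by
  refine ⟨fun A _ _ X hX => SA.finite_Sg hX, fun A _ _ m X hm hX => ?_, SA.superAmalgamation n⟩
  have hfinite := SA.finite_Sg (n := n) X.finite_toSet
  have hcard := SA.card_Sg_le (n := n) X.finite_toSet
  rw [hX] at hfinite hcard
  refine ⟨Set.finite_univ_iff.1 hfinite, ?_⟩
  simpa [Nat.card_univ, hm] using hcard
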